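/- Let $s\ge 1$ and let $m_1,\dots,m_s$ be positive integers with $\gcd(m_1,\dots,m_s)=1$. For $n\ge 1$ let $$a_n=\frac{((m_1+\dots+m_s)n)!}{(m_1n)!\,(m_2n)!\cdots(m_sn)!}$$ be the multinomial coefficient. Then for every positive integer $k$ the sequence $(a_n)_{n\ge 1}$ of nonzero integers is almost mean $k$-divisible; that is, there is a positive integer $C$ (which may depend on $k$ and on $m_1,\dots,m_s$) such that $$\frac{\prod_{n=1}^t a_{kn}}{\prod_{n=1}^t a_n}\in\frac1C\,\mathbb Z$$ for every positive integer $t$. -/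

import Mathlib

/-- The multinomial sequence with parameters `m 0, …, m (s - 1)`: its `n`-th term is the multinomial
coefficient `((∑ i, m i) * n)! / ∏ i, (m i * n)!`. -/
def multinomialSeq {s : ℕ} (m : Fin s → ℕ) (n : ℕ) : ℕ :=
  Nat.multinomial Finset.univ (fun i => m i * n)

/-- A sequence `a 1, a 2, …` of nonzero integers is almost mean `k`-divisible if for some positive
integer `C` all quotients `(∏_{n=1}^t a (k n)) / (∏_{n=1}^t a n)`, `t ≥ 1`, lie in `(1 / C) ℤ`.
The quotients are taken in `ℚ`. -/
def AlmostMeanDivisible (k : ℕ) (a : ℕ → ℤ) : Prop :=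
  (∀ n : ℕ, 0 < n → a n ≠ 0) ∧
    ∃ C : ℕ, 0 < C ∧ ∀ t : ℕ, 0 < t → ∃ z : ℤ,
      (∏ n ∈ Finset.Icc 1 t, (a (k * n) : ℚ)) / (∏ n ∈ Finset.Icc 1 t, (a n : ℚ)) =
        (1 / (C : ℚ)) * (z : ℚ)

/-!
Write `M = ∑ i, m i` and `f q n = ⌊M n / q⌋ - ∑ i, ⌊m i n / q⌋` (`landau`). By Legendre's formula the
`p`-adic valuation of the `n`-th multinomial coefficient `a n` is the sum of `f q n` over the powers
`q` of `p`. In particular `a (p * n)` and `a n` have the same `p`-adic valuation, so that for each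
prime `p` the factor `k` may be replaced by its part prime to `p`. It remains to study, for `q` prime
to `k`, the sums `S q t` of `f q (k n) - f q n` over `n < t` (`landauExcess`): each of them must be
bounded below, and they must be nonnegative for all but finitely many `q`.

Multiplication by `k` permutes the residues modulo `q`, so `S q t` is periodic in `t` with period
`q`, hence bounded. For `t` within `q / M` of the ends of a period `S q t` is nonnegative for every
`q`, because `f q n` takes its least value `0`, respectively its greatest value `s - 1`, there.
In between, with `τ = t / q`, the sum `S q t` is `q` times the integral over `[0, τ]` of
`⌊M k x⌋ - ∑ i, ⌊m i k x⌋ - ⌊M x⌋ + ∑ i, ⌊m i x⌋` up to a bounded error (`le_landauExcess`), and by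
compactness it is enough that this integral is positive for `1 / M ≤ τ ≤ 1 - 1 / M`.

Let `b` be the `1`-periodic function equal to `x (1 - x)` on `[0, 1]`, and `g x = k b(x) - b(k x)`.
Positivity of the integral means `g (M τ) / M < ∑ i, g (m i τ) / m i` (`parabolaDefect_sum_lt`).
Since `b(x) + x ^ 2` is convex and piecewise linear, Jensen's inequality shows that `g x` is the
minimum of `(k - 1) b(y) + k (k - 1) (x - y) ^ 2` over the `y` with `(k - 1) y` an integer. Choose
`y i` attaining the minimum at `m i τ`, and use `∑ i, y i` at `M τ`: the quadratic terms compare by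
the Cauchy-Schwarz inequality and the others by the subadditivity of `b`. In case of equality the
`y i` are integers proportional to the `m i`, so that `∑ i, y i` is divisible by `M` because the `m i`
have greatest common divisor `1`; this forces `M τ` to be closer than `1` to a multiple of `M`.
-/

/-! ### The periodic parabola -/

/-- The `1`-periodic function equal to `x * (1 - x)` on `[0, 1]`. -/
noncomputable def periodicParabola (x : ℝ) : ℝ := Int.fract x * (1 - Int.fract x)

lemma periodicParabola_eq {x : ℝ} {l : ℤ} (h₁ : (l : ℝ) ≤ x) (h₂ : x ≤ l + 1) :
    periodicParabola x = (x - l) * (l + 1 - x) := by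
  unfold periodicParabola
  rcases h₂.lt_or_eq with h | h
  · have : ⌊x⌋ = l := Int.floor_eq_iff.2 ⟨h₁, h⟩
    rw [Int.fract, this]; ring
  · have : Int.fract x = 0 := by
      rw [h]; exact_mod_cast Int.fract_intCast (l + 1)
    rw [this, h]; ring

lemma sub_mul_le_periodicParabola (x : ℝ) (l : ℤ) :
    (x - l) * (l + 1 - x) ≤ periodicParabola x := by
  have h₁ := Int.floor_le x
  have h₂ := Int.lt_floor_add_one x
  rw [periodicParabola_eq h₁ h₂.le]
  rcases lt_trichotomy ⌊x⌋ l with h | h | h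
  · have : (⌊x⌋ : ℝ) + 1 ≤ l := by exact_mod_cast h
    nlinarith
  · rw [h]
  · have : (l : ℝ) + 1 ≤ ⌊x⌋ := by exact_mod_cast h
    nlinarith

lemma continuous_periodicParabola : Continuous periodicParabola :=
  ContinuousOn.comp_fract'' (f := fun x : ℝ => x * (1 - x)) (by fun_prop) (by norm_num)

lemma periodicParabola_nonneg (x : ℝ) : 0 ≤ periodicParabola x :=
  mul_nonneg (Int.fract_nonneg x) (by linarith [Int.fract_lt_one x])

lemma periodicParabola_le (x : ℝ) : periodicParabola x ≤ 1 / 4 := by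
  unfold periodicParabola
  nlinarith [sq_nonneg (Int.fract x - 1 / 2)]

lemma exists_int_of_periodicParabola_eq_zero {x : ℝ} (h : periodicParabola x = 0) :
    ∃ z : ℤ, x = z := by
  rcases mul_eq_zero.1 h with h | h
  · exact ⟨⌊x⌋, by linarith [Int.floor_add_fract x]⟩
  · linarith [Int.fract_lt_one x]

lemma periodicParabola_add_le (x y : ℝ) :
    periodicParabola (x + y) ≤ periodicParabola x + periodicParabola y := by
  have hx := Int.floor_add_fract x
  have hy := Int.floor_add_fract y
  have hx₀ := Int.fract_nonneg x
  have hy₀ := Int.fract_nonneg y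
  have hx₁ := Int.fract_lt_one x
  have hy₁ := Int.fract_lt_one y
  have e : x + y = ⌊x⌋ + ⌊y⌋ + (Int.fract x + Int.fract y) := by linarith
  unfold periodicParabola at *
  rcases le_total (Int.fract x + Int.fract y) 1 with h | h
  · have := periodicParabola_eq (x := x + y) (l := ⌊x⌋ + ⌊y⌋)
      (by push_cast; linarith) (by push_cast; linarith)
    unfold periodicParabola at this
    rw [this, e]
    push_cast
    nlinarith [mul_nonneg hx₀ hy₀]
  · have := periodicParabola_eq (x := x + y) (l := ⌊x⌋ + ⌊y⌋ + 1)
      (by push_cast; linarith) (by push_cast; linarith)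
    unfold periodicParabola at this
    rw [this, e]
    push_cast
    nlinarith [mul_nonneg (sub_nonneg.2 hx₁.le) (sub_nonneg.2 hy₁.le)]

lemma periodicParabola_sum_le {ι : Type*} (s : Finset ι) (y : ι → ℝ) :
    periodicParabola (∑ i ∈ s, y i) ≤ ∑ i ∈ s, periodicParabola (y i) :=
  Finset.le_sum_of_subadditive _ (by simp [periodicParabola]) periodicParabola_add_le s y

/-- Jensen's inequality for the convex piecewise linear function `periodicParabola x + x ^ 2`, at
`x` as the mean of `k - 1` copies of `y` and one copy of `k * x - (k - 1) * y`. -/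
lemma mul_periodicParabola_le {k : ℕ} (hk : 1 ≤ k) (x y : ℝ) (J : ℤ)
    (hy : ((k : ℝ) - 1) * y = J) :
    k * periodicParabola x - periodicParabola (k * x) ≤
      (k - 1) * periodicParabola y + k * (k - 1) * (x - y) ^ 2 := by
  have hk' : (0 : ℝ) ≤ k - 1 := by
    have : (1 : ℝ) ≤ k := by exact_mod_cast hk
    linarith
  rw [periodicParabola_eq (Int.floor_le x) (Int.lt_floor_add_one x).le]
  have h₁ := sub_mul_le_periodicParabola (k * x) (⌊x⌋ + J)
  have h₂ := mul_le_mul_of_nonneg_left (sub_mul_le_periodicParabola y ⌊x⌋) hk'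
  push_cast at h₁
  rw [← hy] at h₁
  linarith

/-- The bound of `mul_periodicParabola_le` is attained: `x`, `y` and `k * x - (k - 1) * y` can be
put into a common interval `[l, l + 1]`, where the convex function is affine. -/
lemma exists_mul_periodicParabola_eq {k : ℕ} (hk : 2 ≤ k) (x : ℝ) :
    ∃ (y : ℝ) (J : ℤ), ((k : ℝ) - 1) * y = J ∧
      k * periodicParabola x - periodicParabola (k * x) =
        (k - 1) * periodicParabola y + k * (k - 1) * (x - y) ^ 2 := by
  have hk' : (0 : ℝ) < k - 1 := by
    have : (2 : ℝ) ≤ k := by exact_mod_cast hk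
    linarith
  have hx := Int.floor_add_fract x
  have hx₀ := Int.fract_nonneg x
  have hx₁ := Int.fract_lt_one x
  set l := ⌊x⌋
  set u := Int.fract x
  set j := ⌊k * u⌋
  have hj₀ : (0 : ℝ) ≤ j := by
    exact_mod_cast Int.floor_nonneg.2 (by positivity : (0 : ℝ) ≤ k * u)
  have hj₁ : (j : ℝ) ≤ k - 1 := by
    have : j < k := Int.floor_lt.2 (by push_cast; nlinarith)
    have : j ≤ (k : ℤ) - 1 := by omega
    exact_mod_cast this
  have hj₂ : (j : ℝ) ≤ k * u := Int.floor_le _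
  have hj₃ : k * u < j + 1 := Int.lt_floor_add_one _
  obtain ⟨w, hw⟩ : ∃ w : ℝ, w = j / (k - 1) := ⟨_, rfl⟩
  have hw' : ((k : ℝ) - 1) * w = j := by rw [hw]; field_simp
  have hw₀ : 0 ≤ w := hw ▸ div_nonneg hj₀ hk'.le
  have hw₁ : w ≤ 1 := hw ▸ (div_le_one hk').2 hj₁
  have hk₁ : k * x = l * k + k * u := by rw [← hx]; ring
  refine ⟨l + w, l * (k - 1) + j, by push_cast; rw [← hw']; ring, ?_⟩
  rw [periodicParabola_eq (x := x) (l := l) (by linarith) (by linarith),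
    periodicParabola_eq (x := l + w) (l := l) (by linarith) (by linarith),
    periodicParabola_eq (x := k * x) (l := l * k + j) (by push_cast; linarith)
      (by push_cast; linarith)]
  push_cast
  rw [← hw', ← hx]
  ring

/-! ### Strict superadditivity of the defect -/

/-- `k` times the periodic parabola at `x`, minus its value at `k * x`. -/
noncomputable def parabolaDefect (k : ℕ) (x : ℝ) : ℝ :=
  k * periodicParabola x - periodicParabola (k * x)

lemma continuous_parabolaDefect (k : ℕ) : Continuous (parabolaDefect k) := by
  have := continuous_periodicParabola
  unfold parabolaDefect
  fun_prop

/-- The defect in the Cauchy-Schwarz inequality `(∑ x i) ^ 2 / ∑ m i ≤ ∑ x i ^ 2 / m i`. -/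
lemma sum_sq_div_sub {s : ℕ} {m : Fin s → ℕ} (hm : ∀ i, 0 < m i) (x : Fin s → ℝ) {M : ℝ}
    (hM : M = ∑ i, (m i : ℝ)) (hM₀ : M ≠ 0) :
    ∑ i, x i ^ 2 / m i - (∑ i, x i) ^ 2 / M =
      ∑ i, m i * (x i / m i - (∑ j, x j) / M) ^ 2 := by
  set X := ∑ j, x j with hX
  have : ∀ i, m i * (x i / m i - X / M) ^ 2 =
      x i ^ 2 / m i - x i * (2 * X / M) + m i * (X / M) ^ 2 := fun i => by
    have : (m i : ℝ) ≠ 0 := by exact_mod_cast (hm i).ne'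
    field_simp
    ring
  simp_rw [this]
  rw [Finset.sum_add_distrib, Finset.sum_sub_distrib, ← Finset.sum_mul, ← Finset.sum_mul, ← hX,
    ← hM]
  field_simp
  ring

/-- If some `m i` were the whole sum, then `s = 1`, so `m i = 1` by the gcd condition. -/
lemma lt_sum_of_gcd_eq_one {s : ℕ} {m : Fin s → ℕ} (hm : ∀ i, 0 < m i)
    (hgcd : Finset.univ.gcd m = 1) {M : ℕ} (hM : M = ∑ i, m i) (hM2 : 2 ≤ M) (i : Fin s) :
    m i < M := by
  have hle : m i ≤ M := hM ▸ Finset.single_le_sum (fun _ _ => Nat.zero_le _) (Finset.mem_univ i)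
  refine hle.lt_of_ne fun h => ?_
  have huniv : (Finset.univ : Finset (Fin s)) = {i} := by
    refine Finset.eq_singleton_iff_unique_mem.2 ⟨Finset.mem_univ i, fun j _ => ?_⟩
    by_contra hj
    have := Finset.add_le_sum (s := Finset.univ) (f := m) (fun _ _ => Nat.zero_le _)
      (Finset.mem_univ i) (Finset.mem_univ j) (Ne.symm hj)
    have := hm j
    omega
  rw [huniv, Finset.gcd_singleton] at hgcd
  have : m i = 1 := by simpa using hgcd
  omega

/-- For an integer `c`, `M * τ` is at distance at least `1` from `M * c`, while the defect is at
most `k / 4`. -/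
lemma parabolaDefect_lt {k M : ℕ} (hk : 2 ≤ k) {τ : ℝ} (h₀ : 1 ≤ M * τ) (h₁ : M * τ ≤ M - 1)
    (c : ℤ) : parabolaDefect k (M * τ) < k * (k - 1) * (M * τ - M * c) ^ 2 := by
  have hk' : (2 : ℝ) ≤ k := by exact_mod_cast hk
  have hM : (2 : ℝ) ≤ M := by linarith
  have hX1 : 1 ≤ (M * τ - M * c) ^ 2 := by
    rw [one_le_sq_iff_one_le_abs, le_abs']
    rcases le_or_gt c 0 with h | h
    · have : (c : ℝ) ≤ 0 := by exact_mod_cast h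
      have := mul_nonpos_of_nonneg_of_nonpos (by linarith : (0 : ℝ) ≤ M) this
      right; linarith
    · have : (1 : ℝ) ≤ c := by exact_mod_cast h
      have := le_mul_of_one_le_right (by linarith : (0 : ℝ) ≤ M) this
      left; linarith
  have hb := mul_le_mul_of_nonneg_left (periodicParabola_le (M * τ)) (by linarith : (0 : ℝ) ≤ k)
  have hb' := periodicParabola_nonneg (k * (M * τ))
  have hkk' : (k : ℝ) ≤ k * (k - 1) := le_mul_of_one_le_right (by linarith) (by linarith)
  have : (k : ℝ) * (k - 1) ≤ k * (k - 1) * (M * τ - M * c) ^ 2 :=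
    le_mul_of_one_le_right (by linarith) hX1
  unfold parabolaDefect
  linarith

/-- Strict superadditivity of the defect. The points `y i` at which the Jensen bound is attained for
`m i * τ` give, with their sum for `M * τ`, the weak inequality; equality would make the `y i`
integers proportional to the `m i`, hence their sum a multiple of `M`. -/
lemma parabolaDefect_sum_lt {s : ℕ} {m : Fin s → ℕ} (hm : ∀ i, 0 < m i)
    (hgcd : Finset.univ.gcd m = 1) {k : ℕ} (hk : 2 ≤ k) {M : ℕ} (hM : M = ∑ i, m i) {τ : ℝ}
    (h₀ : 1 ≤ M * τ) (h₁ : M * τ ≤ M - 1) :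
    parabolaDefect k (M * τ) / M < ∑ i, parabolaDefect k (m i * τ) / m i := by
  by_contra! hcon
  have hk' : (1 : ℝ) ≤ k - 1 := by
    have : (2 : ℝ) ≤ k := by exact_mod_cast hk
    linarith
  have hM2 : (2 : ℝ) ≤ M := by linarith
  have hMsum : (M : ℝ) = ∑ i, (m i : ℝ) := by rw [hM]; push_cast; rfl
  have hm' : ∀ i, (0 : ℝ) < m i := fun i => by exact_mod_cast hm i
  have hlt := lt_sum_of_gcd_eq_one hm hgcd hM (by exact_mod_cast hM2)
  choose y J hJ hy using fun i => exists_mul_periodicParabola_eq hk (m i * τ)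
  have hsum : ∑ i, (m i * τ - y i) = M * τ - ∑ i, y i := by
    rw [Finset.sum_sub_distrib, ← Finset.sum_mul, hMsum]
  have hW := sum_sq_div_sub hm (fun i => m i * τ - y i) hMsum (by linarith)
  rw [hsum] at hW
  have hbound := mul_periodicParabola_le (by omega : 1 ≤ k) (M * τ) (∑ i, y i) (∑ i, J i)
    (by rw [Finset.mul_sum]; push_cast; exact Finset.sum_congr rfl fun i _ => hJ i)
  have hV₁ := periodicParabola_sum_le Finset.univ y
  set Y := ∑ i, y i with hY
  set X := M * τ - Y with hX
  set W := ∑ i, m i * ((m i * τ - y i) / m i - X / M) ^ 2 with hWdef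
  have hV : ∑ i, periodicParabola (y i) * (1 / m i - 1 / M) + periodicParabola Y / M ≤
      ∑ i, periodicParabola (y i) / m i := by
    have := div_le_div_of_nonneg_right hV₁ (by linarith : (0 : ℝ) ≤ M)
    rw [Finset.sum_div] at this
    simp_rw [mul_sub, Finset.sum_sub_distrib, mul_one_div]
    linarith
  have hterm : ∀ i, 0 < (1 : ℝ) / m i - 1 / M := fun i =>
    sub_pos.2 (one_div_lt_one_div_of_lt (hm' i) (by exact_mod_cast hlt i))
  -- `V` and `W` are the losses in subadditivity and in Cauchy-Schwarz; both must vanish.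
  set V := ∑ i, periodicParabola (y i) * (1 / m i - 1 / M)
  have hV₀ : ∀ i ∈ Finset.univ, 0 ≤ periodicParabola (y i) * (1 / m i - 1 / M) := fun i _ =>
    mul_nonneg (periodicParabola_nonneg _) (hterm i).le
  have hW₀ : ∀ i ∈ Finset.univ, 0 ≤ m i * ((m i * τ - y i) / m i - X / M) ^ 2 := fun i _ => by
    positivity
  have hVn : 0 ≤ V := Finset.sum_nonneg hV₀
  have hWn : 0 ≤ W := Finset.sum_nonneg hW₀
  have hdec : ∑ i, parabolaDefect k (m i * τ) / m i =
      (k - 1) * ∑ i, periodicParabola (y i) / m i +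
        k * (k - 1) * ∑ i, (m i * τ - y i) ^ 2 / m i := by
    rw [Finset.mul_sum, Finset.mul_sum, ← Finset.sum_add_distrib]
    refine Finset.sum_congr rfl fun i _ => ?_
    rw [parabolaDefect, hy i]
    ring
  have hkk : (0 : ℝ) < k * (k - 1) := by nlinarith
  have hboundM := div_le_div_of_nonneg_right hbound (by linarith : (0 : ℝ) ≤ M)
  have hsplit : ((k - 1) * periodicParabola Y + k * (k - 1) * X ^ 2) / (M : ℝ) =
      (k - 1) * (periodicParabola Y / M) + k * (k - 1) * (X ^ 2 / M) := by ring
  rw [hsplit] at hboundM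
  rw [hdec, parabolaDefect] at hcon
  have hkV := mul_le_mul_of_nonneg_left hV (by linarith : (0 : ℝ) ≤ k - 1)
  have hkW : (k : ℝ) * (k - 1) * ∑ i, (m i * τ - y i) ^ 2 / m i =
      k * (k - 1) * (X ^ 2 / M) + k * (k - 1) * W := by rw [← hW]; ring
  have hkVn : 0 ≤ ((k : ℝ) - 1) * V := mul_nonneg (by linarith) hVn
  have hkWn : 0 ≤ (k : ℝ) * (k - 1) * W := mul_nonneg hkk.le hWn
  rw [mul_add] at hkV
  have hVz : V = 0 := by
    have : ((k : ℝ) - 1) * V = 0 := by linarith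
    exact (mul_eq_zero.1 this).resolve_left (by linarith)
  have hWz : W = 0 := by
    have : (k : ℝ) * (k - 1) * W = 0 := by linarith
    exact (mul_eq_zero.1 this).resolve_left hkk.ne'
  have hint : ∀ i, ∃ z : ℤ, y i = z := fun i =>
    exists_int_of_periodicParabola_eq_zero <|
      (mul_eq_zero.1 ((Finset.sum_eq_zero_iff_of_nonneg hV₀).1 hVz i (Finset.mem_univ i))
        ).resolve_right (hterm i).ne'
  choose z hz using hint
  have hprop : ∀ i, M * y i = m i * Y := fun i => by
    have h := (mul_eq_zero.1 ((Finset.sum_eq_zero_iff_of_nonneg hW₀).1 hWz i (Finset.mem_univ i))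
      ).resolve_left (hm' i).ne'
    have h := pow_eq_zero_iff (two_ne_zero) |>.1 h
    have := (hm' i).ne'
    have : (M : ℝ) ≠ 0 := by linarith
    rw [sub_eq_zero] at h
    field_simp at h
    rw [hX] at h
    linarith
  have hYz : Y = (∑ i, z i : ℤ) := by
    rw [hY]; push_cast; exact Finset.sum_congr rfl fun i _ => hz i
  -- `M` divides every `m i * Y`, hence their greatest common divisor `Y`.
  have hdvd : M ∣ (∑ i, z i).natAbs := by
    have : M ∣ Finset.univ.gcd fun i => m i * (∑ i, z i).natAbs := by
      refine Finset.dvd_gcd fun i _ => ?_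
      have h : (M : ℤ) * z i = m i * ∑ i, z i := by
        have := hprop i
        rw [hYz, hz i] at this
        exact_mod_cast this
      have := Int.natAbs_dvd_natAbs.2 (Dvd.intro _ h)
      simpa [Int.natAbs_mul] using this
    rwa [Finset.gcd_mul_right, hgcd, one_mul, normalize_eq] at this
  obtain ⟨c, hc⟩ := Int.natCast_dvd.2 hdvd
  have hYc : Y = M * c := by rw [hYz, hc]; push_cast; rfl
  have hge : k * (k - 1) * X ^ 2 ≤
      k * periodicParabola (M * τ) - periodicParabola (k * (M * τ)) := by
    have h : ((k - 1) * periodicParabola Y + k * (k - 1) * X ^ 2) / (M : ℝ) ≤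
        (k * periodicParabola (M * τ) - periodicParabola (k * (M * τ))) / M := by
      rw [hsplit]; linarith
    have h := (div_le_div_iff_of_pos_right (by linarith : (0 : ℝ) < M)).1 h
    have := mul_nonneg (by linarith : (0 : ℝ) ≤ k - 1) (periodicParabola_nonneg Y)
    linarith
  exact absurd hge (not_le.2 (hX ▸ hYc ▸ parabolaDefect_lt hk h₀ h₁ c))

/-! ### The Landau function of the multinomial sequence -/

/-- The step function `⌊M n / q⌋ - ∑ i, ⌊m i n / q⌋`, with `M` the sum of the `m i`. By Legendre's
formula its values at the powers `q` of a prime `p` add up to the `p`-adic valuation of the `n`-th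
multinomial coefficient. -/
def landau {s : ℕ} (m : Fin s → ℕ) (q n : ℕ) : ℤ :=
  (((∑ i, m i) * n / q : ℕ) : ℤ) - ∑ i, ((m i * n / q : ℕ) : ℤ)

section

variable {s : ℕ} {m : Fin s → ℕ} {q k : ℕ}

lemma landau_nonneg (hq : 0 < q) (n : ℕ) : 0 ≤ landau m q n := by
  rw [landau, sub_nonneg]
  norm_cast
  rw [Nat.le_div_iff_mul_le hq, Finset.sum_mul, Finset.sum_mul]
  exact Finset.sum_le_sum fun i _ => Nat.div_mul_le_self _ _

lemma landau_le (hs : 0 < s) (hq : 0 < q) (n : ℕ) : landau m q n ≤ s - 1 := by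
  have : Nonempty (Fin s) := ⟨⟨0, hs⟩⟩
  have h : (∑ i, m i) * n / q < (∑ i, m i * n / q) + s := by
    refine Nat.div_lt_of_lt_mul ?_
    have : (∑ i, m i) * n < ∑ i, q * (m i * n / q + 1) := by
      rw [Finset.sum_mul]
      exact Finset.sum_lt_sum_of_nonempty Finset.univ_nonempty fun i _ =>
        Nat.lt_mul_div_succ _ hq
    rw [← Finset.mul_sum, Finset.sum_add_distrib] at this
    simpa using this
  have h := Int.ofNat_lt.2 h
  rw [Nat.cast_add, Nat.cast_sum] at h
  rw [landau]
  linarith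

lemma landau_eq_zero_of_lt {n : ℕ} (h : (∑ i, m i) * n < q) : landau m q n = 0 := by
  have h' : ∀ i, m i * n / q = 0 := fun i => Nat.div_eq_of_lt <| lt_of_le_of_lt
    (Nat.mul_le_mul_right n (Finset.single_le_sum (f := m) (fun _ _ => Nat.zero_le _)
      (Finset.mem_univ i))) h
  simp [landau, Nat.div_eq_of_lt h, h']

lemma mul_div_eq_sub_one {a n : ℕ} (ha : 0 < a) (hn : n < q) (h : a * (q - n) ≤ q) :
    ((a * n / q : ℕ) : ℤ) = a - 1 := by
  have : a * n / q = a - 1 := by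
    obtain ⟨b, rfl⟩ : ∃ b, a = b + 1 := ⟨a - 1, by omega⟩
    obtain ⟨d, rfl⟩ : ∃ d, q = n + d := ⟨q - n, by omega⟩
    rw [Nat.add_sub_cancel_left] at h
    rw [Nat.add_sub_cancel, Nat.div_eq_iff (by omega)]
    have : 0 < d := by omega
    exact ⟨by nlinarith, Nat.le_sub_one_of_lt (by nlinarith)⟩
  rw [this]
  omega

/-- Just to the left of a period the Landau function takes its greatest value. -/
lemma landau_eq_of_mul_sub_le (hs : 0 < s) (hm : ∀ i, 0 < m i) {n : ℕ} (hn : n < q)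
    (h : (∑ i, m i) * (q - n) ≤ q) : landau m q n = s - 1 := by
  have hle : ∀ i, m i ≤ ∑ i, m i := fun i =>
    Finset.single_le_sum (f := m) (fun _ _ => Nat.zero_le _) (Finset.mem_univ i)
  have hM : 0 < ∑ i, m i := (hm ⟨0, hs⟩).trans_le (hle _)
  have h' : ∀ i, ((m i * n / q : ℕ) : ℤ) = m i - 1 := fun i =>
    mul_div_eq_sub_one (hm i) hn ((Nat.mul_le_mul_right _ (hle i)).trans h)
  rw [landau, mul_div_eq_sub_one hM hn h]
  simp_rw [h']
  simp

lemma landau_add_mul (hq : 0 < q) (n j : ℕ) : landau m q (n + q * j) = landau m q n := by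
  have h : ∀ a : ℕ, a * (n + q * j) / q = a * n / q + a * j := fun a => by
    rw [mul_add, mul_left_comm, Nat.add_mul_div_left _ _ hq]
  simp_rw [landau, h]
  push_cast
  rw [Finset.sum_add_distrib, ← Finset.sum_mul]
  ring

lemma landau_mod (hq : 0 < q) (n : ℕ) : landau m q (n % q) = landau m q n := by
  conv_rhs => rw [← Nat.mod_add_div n q, landau_add_mul hq]

/-- Multiplication by `k` permutes the residues modulo `q`. -/
lemma sum_landau_mul (hq : 0 < q) (hk : k.Coprime q) :
    ∑ n ∈ Finset.range q, landau m q (k * n) = ∑ n ∈ Finset.range q, landau m q n := by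
  have hmaps : ∀ n ∈ Finset.range q, k * n % q ∈ Finset.range q := fun n _ =>
    Finset.mem_range.2 (Nat.mod_lt _ hq)
  have hinj : Set.InjOn (fun n => k * n % q) (Finset.range q) := fun a ha b hb hab => by
    have : a ≡ b [MOD q] := Nat.ModEq.cancel_left_of_coprime (Nat.coprime_comm.1 hk) hab
    exact this.eq_of_lt_of_lt (Finset.mem_range.1 ha) (Finset.mem_range.1 hb)
  exact Finset.sum_nbij (fun n => k * n % q) hmaps hinj
    (Finset.surjOn_of_injOn_of_card_le _ hmaps hinj le_rfl) fun n _ => (landau_mod hq _).symm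

/-- The excess of `landau m q` along the multiples of `k` over its values at consecutive integers,
up to `t` (excluded). -/
def landauExcess {s : ℕ} (m : Fin s → ℕ) (q k t : ℕ) : ℤ :=
  ∑ n ∈ Finset.range t, (landau m q (k * n) - landau m q n)

lemma landauExcess_self (hq : 0 < q) (hk : k.Coprime q) : landauExcess m q k q = 0 := by
  rw [landauExcess, Finset.sum_sub_distrib, sum_landau_mul hq hk, sub_self]

lemma landauExcess_add_mul (hq : 0 < q) (hk : k.Coprime q) (t j : ℕ) :
    landauExcess m q k (t + q * j) = landauExcess m q k t := by
  induction j with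
  | zero => simp
  | succ j ih =>
    rw [← ih, show t + q * (j + 1) = q + (t + q * j) by ring, landauExcess,
      Finset.sum_range_add]
    have h₀ := landauExcess_self (m := m) hq hk
    rw [landauExcess] at h₀
    rw [h₀, zero_add, landauExcess]
    refine Finset.sum_congr rfl fun n _ => ?_
    have h₁ := landau_add_mul (m := m) hq n 1
    have h₂ := landau_add_mul (m := m) hq (k * n) k
    rw [show k * (q + n) = k * n + q * k by ring, h₂, show q + n = n + q * 1 by ring, h₁]

lemma landauExcess_mod (hq : 0 < q) (hk : k.Coprime q) (t : ℕ) :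
    landauExcess m q k (t % q) = landauExcess m q k t := by
  conv_rhs => rw [← Nat.mod_add_div t q, landauExcess_add_mul hq hk]

lemma neg_sum_landau_le_landauExcess (hq : 0 < q) (hk : k.Coprime q) (t : ℕ) :
    -∑ n ∈ Finset.range q, landau m q n ≤ landauExcess m q k t := by
  rw [← landauExcess_mod hq hk, landauExcess, Finset.sum_sub_distrib]
  have h₁ : 0 ≤ ∑ n ∈ Finset.range (t % q), landau m q (k * n) :=
    Finset.sum_nonneg fun n _ => landau_nonneg hq _
  have h₂ : ∑ n ∈ Finset.range (t % q), landau m q n ≤ ∑ n ∈ Finset.range q, landau m q n :=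
    Finset.sum_le_sum_of_subset_of_nonneg (Finset.range_mono (Nat.mod_lt _ hq).le)
      fun n _ _ => landau_nonneg hq _
  linarith

/-- At the start of a period the Landau function vanishes. -/
lemma landauExcess_nonneg_of_mul_le (hq : 0 < q) {t : ℕ} (h : (∑ i, m i) * t ≤ q) :
    0 ≤ landauExcess m q k t := by
  refine Finset.sum_nonneg fun n hn => ?_
  have hn := Finset.mem_range.1 hn
  have hlt : (∑ i, m i) * n < q := by
    rcases Nat.eq_zero_or_pos (∑ i, m i) with h' | h'
    · simpa [h'] using hq
    · exact (Nat.mul_lt_mul_of_pos_left hn h').trans_le h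
  rw [landau_eq_zero_of_lt hlt, sub_zero]
  exact landau_nonneg hq _

/-- At the end of a period the Landau function is maximal, so the excess decreases to `0` there. -/
lemma landauExcess_nonneg_of_mul_sub_le (hs : 0 < s) (hm : ∀ i, 0 < m i) (hq : 0 < q)
    (hk : k.Coprime q) {t : ℕ} (ht : t ≤ q) (h : (∑ i, m i) * (q - t) ≤ q) :
    0 ≤ landauExcess m q k t := by
  have h₀ := landauExcess_self (m := m) hq hk
  rw [landauExcess, ← Finset.sum_range_add_sum_Ico _ ht] at h₀
  have h₁ : ∑ n ∈ Finset.Ico t q, (landau m q (k * n) - landau m q n) ≤ 0 := by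
    refine Finset.sum_nonpos fun n hn => ?_
    have hn := Finset.mem_Ico.1 hn
    rw [landau_eq_of_mul_sub_le hs hm hn.2
      ((Nat.mul_le_mul_left _ (Nat.sub_le_sub_left hn.1 q)).trans h)]
    linarith [landau_le (m := m) hs hq (k * n)]
  rw [landauExcess]
  linarith

/-! ### Comparison of sums of floors with integrals -/

/-- Twice the integral of the floor function over `[0, x]`. -/
noncomputable def twiceFloorIntegral (x : ℝ) : ℝ := x ^ 2 - x + periodicParabola x

lemma le_twiceFloorIntegral (x : ℝ) (l : ℤ) : 2 * l * x - l * (l + 1) ≤ twiceFloorIntegral x := by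
  have := sub_mul_le_periodicParabola x l
  unfold twiceFloorIntegral
  linarith

lemma twiceFloorIntegral_eq {x : ℝ} {l : ℤ} (h₁ : (l : ℝ) ≤ x) (h₂ : x ≤ l + 1) :
    twiceFloorIntegral x = 2 * l * x - l * (l + 1) := by
  rw [twiceFloorIntegral, periodicParabola_eq h₁ h₂]
  ring

lemma twiceFloorIntegral_natCast_div (hq : 0 < q) (a : ℕ) :
    twiceFloorIntegral ((a : ℝ) / q) =
      2 * (a / q : ℕ) * ((a : ℝ) / q) - (a / q : ℕ) * ((a / q : ℕ) + 1) := by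
  have hq' : (0 : ℝ) < q := by exact_mod_cast hq
  have h₁ : ((a / q : ℕ) : ℝ) ≤ (a : ℝ) / q := Nat.cast_div_le
  have h₂ : (a : ℝ) / q ≤ (a / q : ℕ) + 1 := by
    rw [div_le_iff₀ hq']
    exact_mod_cast (Nat.lt_mul_div_succ a hq).le.trans_eq (mul_comm _ _)
  have := twiceFloorIntegral_eq (x := (a : ℝ) / q) (l := ((a / q : ℕ) : ℤ))
    (by rwa [Int.cast_natCast]) (by rwa [Int.cast_natCast])
  rwa [Int.cast_natCast] at this

lemma sum_div_le_twiceFloorIntegral (hq : 0 < q) (a t : ℕ) :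
    2 * (a / q : ℝ) * ∑ n ∈ Finset.range t, ((a * n / q : ℕ) : ℝ) ≤
      twiceFloorIntegral (a * (t / q)) := by
  induction t with
  | zero => simp [twiceFloorIntegral, periodicParabola]
  | succ t ih =>
    rw [Finset.sum_range_succ, mul_add]
    have h₁ := le_twiceFloorIntegral (a * ((t + 1 : ℕ) / q)) ((a * t / q : ℕ) : ℤ)
    have h₂ := twiceFloorIntegral_natCast_div hq (a * t)
    rw [show ((a * t : ℕ) : ℝ) / q = a * (t / q) by push_cast; ring] at h₂
    have e : (a : ℝ) * ((t + 1 : ℕ) / q) = a * (t / q) + a / q := by push_cast; ring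
    rw [e] at h₁ ⊢
    rw [Int.cast_natCast] at h₁
    linarith

lemma twiceFloorIntegral_le_sum_div (hq : 0 < q) (a t : ℕ) :
    twiceFloorIntegral (a * (t / q)) ≤
      2 * (a / q : ℝ) * ((∑ n ∈ Finset.range t, ((a * n / q : ℕ) : ℝ)) + (a * t / q : ℕ)) := by
  induction t with
  | zero => simp [twiceFloorIntegral, periodicParabola]
  | succ t ih =>
    rw [Finset.sum_range_succ]
    have h₁ := le_twiceFloorIntegral (a * (t / q)) ((a * (t + 1) / q : ℕ) : ℤ)
    have h₂ := twiceFloorIntegral_natCast_div hq (a * (t + 1))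
    rw [show ((a * (t + 1) : ℕ) : ℝ) / q = a * (t / q) + a / q by push_cast; ring] at h₂
    have e : (a : ℝ) * ((t + 1 : ℕ) / q) = a * (t / q) + a / q := by push_cast; ring
    rw [e]
    rw [Int.cast_natCast] at h₁
    linarith

lemma sum_div_le (hq : 0 < q) {a t : ℕ} (ha : 0 < a) :
    ∑ n ∈ Finset.range t, ((a * n / q : ℕ) : ℝ) ≤
      q / 2 * (a * (t / q : ℝ) ^ 2 - t / q + periodicParabola (a * (t / q)) / a) := by
  have h := sum_div_le_twiceFloorIntegral hq a t
  have hq' : (0 : ℝ) < q := by exact_mod_cast hq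
  have ha' : (0 : ℝ) < a := by exact_mod_cast ha
  have hc : (0 : ℝ) ≤ q / (2 * a) := by positivity
  have := mul_le_mul_of_nonneg_left h hc
  calc _ = q / (2 * a) * (2 * (a / q : ℝ) * ∑ n ∈ Finset.range t, ((a * n / q : ℕ) : ℝ)) := by
        field_simp
    _ ≤ _ := this
    _ = _ := by
        unfold twiceFloorIntegral
        generalize periodicParabola (a * (t / q)) = b
        field_simp

lemma le_sum_div_add (hq : 0 < q) {a t : ℕ} (ha : 0 < a) (ht : t ≤ q) :
    q / 2 * (a * (t / q : ℝ) ^ 2 - t / q + periodicParabola (a * (t / q)) / a) ≤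
      ∑ n ∈ Finset.range t, ((a * n / q : ℕ) : ℝ) + a := by
  have h := twiceFloorIntegral_le_sum_div hq a t
  have hq' : (0 : ℝ) < q := by exact_mod_cast hq
  have ha' : (0 : ℝ) < a := by exact_mod_cast ha
  have hc : (0 : ℝ) ≤ q / (2 * a) := by positivity
  have hlast : ((a * t / q : ℕ) : ℝ) ≤ a := by
    exact_mod_cast Nat.div_le_of_le_mul (by rw [mul_comm]; exact Nat.mul_le_mul_right a ht)
  calc _ = q / (2 * a) * twiceFloorIntegral (a * (t / q)) := by
        unfold twiceFloorIntegral
        generalize periodicParabola (a * (t / q)) = b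
        field_simp
    _ ≤ _ := mul_le_mul_of_nonneg_left h hc
    _ = ∑ n ∈ Finset.range t, ((a * n / q : ℕ) : ℝ) + (a * t / q : ℕ) := by field_simp
    _ ≤ _ := by linarith

/-- Up to a bounded error, the excess is `q` times the integral over `[0, t / q]` of the
corresponding step function, which is expressed through `parabolaDefect`: the quadratic and linear
terms of the integrals of the floor functions cancel. -/
lemma le_landauExcess (hs : 0 < s) (hm : ∀ i, 0 < m i) {M : ℕ} (hM : M = ∑ i, m i) (hq : 0 < q)
    (hk : 0 < k) {t : ℕ} (ht : t ≤ q) :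
    (q : ℝ) / (2 * k) * (∑ i, parabolaDefect k (m i * (t / q)) / m i -
      parabolaDefect k (M * (t / q)) / M) - (k + 1) * M ≤ landauExcess m q k t := by
  have hM₀ : 0 < M := hM ▸ (hm ⟨0, hs⟩).trans_le
    (Finset.single_le_sum (f := m) (fun _ _ => Nat.zero_le _) (Finset.mem_univ _))
  have hMsum : (M : ℝ) = ∑ i, (m i : ℝ) := by rw [hM]; push_cast; rfl
  have hexp : (landauExcess m q k t : ℝ) =
      ∑ n ∈ Finset.range t, ((M * k * n / q : ℕ) : ℝ) -
        ∑ i, ∑ n ∈ Finset.range t, ((m i * k * n / q : ℕ) : ℝ) -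
      (∑ n ∈ Finset.range t, ((M * n / q : ℕ) : ℝ) -
        ∑ i, ∑ n ∈ Finset.range t, ((m i * n / q : ℕ) : ℝ)) := by
    simp_rw [landauExcess, landau, ← hM, ← mul_assoc]
    rw [Finset.sum_comm (s := Finset.univ), Finset.sum_comm (s := Finset.univ),
      ← Finset.sum_sub_distrib, ← Finset.sum_sub_distrib, ← Finset.sum_sub_distrib,
      Int.cast_sum]
    refine Finset.sum_congr rfl fun n _ => ?_
    rw [Int.cast_sub, Int.cast_sub, Int.cast_sub, Int.cast_sum, Int.cast_sum]
    simp_rw [Int.cast_natCast]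
  have h₁ := le_sum_div_add hq (Nat.mul_pos hM₀ hk) ht
  have h₂ := Finset.sum_le_sum fun i (_ : i ∈ Finset.univ) =>
    sum_div_le (t := t) hq (Nat.mul_pos (hm i) hk)
  have h₃ := sum_div_le (t := t) hq hM₀
  have h₄ := Finset.sum_le_sum fun i (_ : i ∈ Finset.univ) => le_sum_div_add hq (hm i) ht
  rw [Finset.sum_add_distrib, ← hMsum] at h₄
  rw [← Finset.mul_sum, Finset.sum_add_distrib, Finset.sum_sub_distrib] at h₂ h₄
  have hk' : (k : ℝ) ≠ 0 := by positivity
  have hM' : (M : ℝ) ≠ 0 := by positivity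
  have e₁ : ∑ i, ((m i * k : ℕ) : ℝ) * (t / q : ℝ) ^ 2 = M * k * (t / q : ℝ) ^ 2 := by
    rw [hMsum, Finset.sum_mul, Finset.sum_mul]; push_cast; rfl
  have e₂ : ∑ i, (m i : ℝ) * (t / q : ℝ) ^ 2 = M * (t / q : ℝ) ^ 2 := by
    rw [hMsum, Finset.sum_mul]
  have e₃ : ∀ a : ℕ, periodicParabola ((a * k : ℕ) * (t / q)) / (a * k : ℕ) =
      periodicParabola (a * (t / q)) / a - parabolaDefect k (a * (t / q)) / a / k := fun a => by
    rcases Nat.eq_zero_or_pos a with rfl | ha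
    · simp
    have ha' : (a : ℝ) ≠ 0 := by positivity
    rw [parabolaDefect, show (k : ℝ) * (a * (t / q)) = (a * k : ℕ) * (t / q) by push_cast; ring]
    push_cast
    field_simp
    ring
  rw [e₁] at h₂
  rw [e₂] at h₄
  simp_rw [e₃] at h₁ h₂
  rw [Finset.sum_sub_distrib, ← Finset.sum_div _ _ (k : ℝ)] at h₂
  push_cast at h₁
  rw [hexp]
  have e₄ : ∀ x : ℝ, (q : ℝ) / (2 * k) * x = q / 2 * (x / k) := fun x => by field_simp
  rw [e₄, sub_div]
  linarith

/-! ### Nonnegativity of the excess for large moduli -/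

lemma exists_landauExcess_nonneg (hm : ∀ i, 0 < m i) (hgcd : Finset.univ.gcd m = 1)
    (hk : 0 < k) : ∃ Q : ℕ, ∀ q, Q ≤ q → 0 < q → k.Coprime q → ∀ t, 0 ≤ landauExcess m q k t := by
  rcases (by omega : k = 1 ∨ 2 ≤ k) with rfl | hk2
  -- For `k = 1` there is no strict inequality to use, but the excess is identically zero.
  · exact ⟨0, fun q _ _ _ t => by simp [landauExcess]⟩
  have hs : 0 < s := by
    rcases Nat.eq_zero_or_pos s with rfl | h
    · simp at hgcd
    · exact h
  obtain ⟨M, hM⟩ : ∃ M, M = ∑ i, m i := ⟨_, rfl⟩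
  have hM₀ : 0 < M := hM ▸ (hm ⟨0, hs⟩).trans_le
    (Finset.single_le_sum (f := m) (fun _ _ => Nat.zero_le _) (Finset.mem_univ _))
  have hM' : (0 : ℝ) < M := by exact_mod_cast hM₀
  set E : ℝ → ℝ := fun τ =>
    ∑ i, parabolaDefect k (m i * τ) / m i - parabolaDefect k (M * τ) / M with hE
  have hcont : Continuous E := by
    have := continuous_parabolaDefect k
    fun_prop
  obtain ⟨δ, hδ, hmin⟩ : ∃ δ > 0, ∀ τ ∈ Set.Icc (1 / M : ℝ) (1 - 1 / M), δ ≤ E τ := by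
    -- The interval is empty when `M = 1`.
    rcases (Set.Icc (1 / M : ℝ) (1 - 1 / M)).eq_empty_or_nonempty with h | h
    · exact ⟨1, one_pos, fun τ hτ => absurd (h ▸ hτ) (Set.notMem_empty τ)⟩
    obtain ⟨τ, hτ, hmin⟩ := isCompact_Icc.exists_isMinOn h hcont.continuousOn
    refine ⟨E τ, sub_pos.2 (parabolaDefect_sum_lt hm hgcd hk2 hM ?_ ?_), hmin⟩
    · have := mul_le_mul_of_nonneg_left hτ.1 hM'.le
      rwa [mul_one_div_cancel hM'.ne'] at this
    · have := mul_le_mul_of_nonneg_left hτ.2 hM'.le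
      rwa [mul_sub, mul_one_div_cancel hM'.ne', mul_one] at this
  -- From this `Q` on, the main term `q * δ / (2 * k)` outweighs the error `(k + 1) * M`.
  obtain ⟨Q, hQ⟩ := exists_nat_ge (2 * k * ((k + 1) * M) / δ)
  refine ⟨Q, fun q hQq hq hkq t => ?_⟩
  rw [← landauExcess_mod hq hkq]
  have ht := Nat.mod_lt t hq
  generalize t % q = t at ht
  by_cases h₁ : (∑ i, m i) * t ≤ q
  · exact landauExcess_nonneg_of_mul_le hq h₁
  by_cases h₂ : (∑ i, m i) * (q - t) ≤ q
  · exact landauExcess_nonneg_of_mul_sub_le hs hm hq hkq ht.le h₂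
  rw [← hM] at h₁ h₂
  have hq' : (0 : ℝ) < q := by exact_mod_cast hq
  have hk' : (0 : ℝ) < k := by exact_mod_cast hk
  have h₁ : (q : ℝ) ≤ M * t := by exact_mod_cast (not_le.1 h₁).le
  have h₂ : (q : ℝ) ≤ M * (q - t) := by
    rw [← Nat.cast_sub ht.le]
    exact_mod_cast (not_le.1 h₂).le
  have hδE := hmin (t / q) ⟨(div_le_div_iff₀ hM' hq').2 (by linarith), by
    rw [le_sub_iff_add_le, div_add_div _ _ hq'.ne' hM'.ne', div_le_one (by positivity)]
    linarith⟩
  have hle := le_landauExcess hs hm hM hq hk ht.le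
  have hbig : 2 * k * ((k + 1) * M) ≤ q * δ :=
    (div_le_iff₀ hδ).1 (hQ.trans (by exact_mod_cast hQq))
  have hmain : (k + 1) * M ≤ (q : ℝ) / (2 * k) * E (t / q) := by
    rw [div_mul_eq_mul_div, le_div_iff₀ (by positivity)]
    linarith [mul_le_mul_of_nonneg_left hδE hq'.le]
  have : (0 : ℝ) ≤ landauExcess m q k t := by
    simp only [hE] at hmain
    linarith
  exact_mod_cast this

/-! ### Valuations of the multinomial sequence -/

lemma multinomialSeq_pos (m : Fin s → ℕ) (n : ℕ) : 0 < multinomialSeq m n := by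
  refine Nat.pos_of_ne_zero fun h => ?_
  have := Nat.multinomial_spec Finset.univ fun i => m i * n
  rw [multinomialSeq] at h
  rw [h, mul_zero] at this
  exact Nat.factorial_ne_zero _ this.symm

/-- Legendre's formula for the multinomial sequence. -/
lemma factorization_multinomialSeq {p : ℕ} (hp : p.Prime) {n b : ℕ}
    (hb : (∑ i, m i) * n < b) :
    ((multinomialSeq m n).factorization p : ℤ) = ∑ r ∈ Finset.Ico 1 b, landau m (p ^ r) n := by
  have hspec : (∏ i, (m i * n).factorial) * multinomialSeq m n = (∑ i, m i * n).factorial :=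
    Nat.multinomial_spec Finset.univ fun i => m i * n
  rw [← Finset.sum_mul] at hspec
  have hfac : ∀ a ≤ (∑ i, m i) * n,
      a.factorial.factorization p = ∑ r ∈ Finset.Ico 1 b, a / p ^ r := fun a ha =>
    Nat.factorization_factorial hp (((Nat.log_le_self p a).trans ha).trans_lt hb)
  have h := congrArg (fun x => x.factorization p) hspec
  rw [hfac _ le_rfl, Nat.factorization_mul (Finset.prod_ne_zero_iff.2 fun i _ =>
    Nat.factorial_ne_zero _) (multinomialSeq_pos m n).ne', Finsupp.add_apply,
    Nat.factorization_prod_apply fun i _ => Nat.factorial_ne_zero _] at h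
  have hi : ∀ i, (m i * n).factorial.factorization p = ∑ r ∈ Finset.Ico 1 b, m i * n / p ^ r :=
    fun i => hfac _ (Nat.mul_le_mul_right n
      (Finset.single_le_sum (f := m) (fun _ _ => Nat.zero_le _) (Finset.mem_univ i)))
  simp_rw [hi] at h
  simp_rw [landau]
  rw [Finset.sum_sub_distrib, Finset.sum_comm, ← Nat.cast_sum, eq_sub_iff_add_eq, add_comm]
  rw [← h]
  push_cast
  rfl

/-- Multiplying the index by `p` does not change the `p`-adic valuation: in Legendre's formula the
level `r + 1` for `p * n` is the level `r` for `n`, and the level `1` for `p * n` is `0`. -/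
lemma factorization_multinomialSeq_mul {p : ℕ} (hp : p.Prime) (n : ℕ) :
    (multinomialSeq m (p * n)).factorization p = (multinomialSeq m n).factorization p := by
  have hstep : ∀ a r : ℕ, a * (p * n) / p ^ (r + 1) = a * n / p ^ r := fun a r => by
    rw [mul_left_comm, pow_succ', Nat.mul_div_mul_left _ _ hp.pos]
  have hb : (∑ i, m i) * n ≤ (∑ i, m i) * (p * n) :=
    Nat.mul_le_mul_left _ (Nat.le_mul_of_pos_left n hp.pos)
  have h₁ := factorization_multinomialSeq (m := m) hp (n := p * n)
    (b := (∑ i, m i) * (p * n) + 1 + 1) (by omega)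
  have h₂ := factorization_multinomialSeq (m := m) hp (n := n)
    (b := (∑ i, m i) * (p * n) + 1) (by omega)
  have : ∀ r, landau m (p ^ (r + 1)) (p * n) = landau m (p ^ r) n := fun r => by
    simp_rw [landau, hstep]
  rw [← Finset.sum_Ico_add' _ 0 _ 1, Finset.sum_eq_sum_Ico_succ_bot (by omega)] at h₁
  simp_rw [this] at h₁
  have h₀ : landau m (p ^ 0) n = 0 := by
    simp [landau, Finset.sum_mul]
  rw [h₀, zero_add, zero_add, ← h₂] at h₁
  exact_mod_cast h₁

lemma factorization_multinomialSeq_pow_mul {p : ℕ} (hp : p.Prime) (e n : ℕ) :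
    (multinomialSeq m (p ^ e * n)).factorization p = (multinomialSeq m n).factorization p := by
  induction e with
  | zero => simp
  | succ e ih => rw [pow_succ', mul_assoc, factorization_multinomialSeq_mul hp, ih]

lemma sum_factorization_sub {p : ℕ} (hp : p.Prime) (hk : 0 < k) {t b : ℕ}
    (hb : (∑ i, m i) * (k * t) < b) :
    ∑ n ∈ Finset.Icc 1 t, ((multinomialSeq m (k * n)).factorization p : ℤ) -
      ∑ n ∈ Finset.Icc 1 t, ((multinomialSeq m n).factorization p : ℤ) =
      ∑ r ∈ Finset.Ico 1 b, landauExcess m (p ^ r) k (t + 1) := by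
  have hzero : ∀ r, landau m (p ^ r) 0 = 0 := fun r => by simp [landau]
  simp_rw [landauExcess]
  rw [Finset.sum_comm, Finset.sum_range_succ', ← Finset.sum_sub_distrib]
  simp only [mul_zero, hzero, sub_zero, Finset.sum_const_zero, add_zero]
  rw [Finset.range_eq_Ico, Finset.sum_Ico_add' (fun n => ∑ r ∈ Finset.Ico 1 b,
    (landau m (p ^ r) (k * n) - landau m (p ^ r) n)) 0 t 1, zero_add]
  refine Finset.sum_congr rfl fun n hn => ?_
  have hn := (Finset.mem_Icc.1 hn).2
  have h₁ : (∑ i, m i) * (k * n) < b :=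
    (Nat.mul_le_mul_left _ (Nat.mul_le_mul_left _ hn)).trans_lt hb
  have h₂ : (∑ i, m i) * n < b :=
    (Nat.mul_le_mul_left _ (Nat.le_mul_of_pos_left n hk)).trans_lt h₁
  rw [factorization_multinomialSeq hp h₁, factorization_multinomialSeq hp h₂,
    Finset.sum_sub_distrib]

/-- For the primes `p` not dividing `k`, the valuation of the quotient of products is bounded below,
and it is nonnegative for all but finitely many of them. -/
lemma exists_sum_factorization_le_of_coprime (hm : ∀ i, 0 < m i)
    (hgcd : Finset.univ.gcd m = 1) (hk : 0 < k) :
    ∃ (Q : ℕ) (B : ℕ → ℕ), (∀ p, Q ≤ p → B p = 0) ∧ ∀ p, p.Prime → k.Coprime p → ∀ t,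
      ∑ n ∈ Finset.Icc 1 t, (multinomialSeq m n).factorization p ≤
        ∑ n ∈ Finset.Icc 1 t, (multinomialSeq m (k * n)).factorization p + B p := by
  obtain ⟨Q, hQ⟩ := exists_landauExcess_nonneg hm hgcd hk
  refine ⟨Q, fun p => if Q ≤ p then 0 else
    (∑ r ∈ Finset.Ico 1 Q, ∑ n ∈ Finset.range (p ^ r), landau m (p ^ r) n).toNat,
    fun p hp => by simp [hp], fun p hp hkp t => ?_⟩
  have hcop : ∀ r, k.Coprime (p ^ r) := fun r => hkp.pow_right r
  have hpos : ∀ r, 0 < p ^ r := fun r => pow_pos hp.pos r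
  -- The bound `b` is large enough for Legendre's formula and exceeds `Q`.
  have h := sum_factorization_sub (m := m) hp hk (t := t)
    (b := (∑ i, m i) * (k * t) + 1 + Q) (by omega)
  generalize hb : (∑ i, m i) * (k * t) + 1 + Q = b at h
  have hQb : Q ≤ b := by omega
  dsimp only
  split_ifs with hQp
  · have : 0 ≤ ∑ r ∈ Finset.Ico 1 b, landauExcess m (p ^ r) k (t + 1) :=
      Finset.sum_nonneg fun r hr => hQ _ (hQp.trans (Nat.le_self_pow
        (Nat.one_le_iff_ne_zero.1 (Finset.mem_Ico.1 hr).1) p)) (hpos r) (hcop r) _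
    zify
    linarith
  · have h₁ : -∑ r ∈ Finset.Ico 1 Q, ∑ n ∈ Finset.range (p ^ r), landau m (p ^ r) n ≤
        ∑ r ∈ Finset.Ico 1 b, landauExcess m (p ^ r) k (t + 1) := by
      rw [← Finset.sum_filter_add_sum_filter_not (Finset.Ico 1 b) (· < Q)]
      have hfilter : (Finset.Ico 1 b).filter (· < Q) = Finset.Ico 1 Q := by
        ext r; simp only [Finset.mem_filter, Finset.mem_Ico]; omega
      rw [hfilter, ← Finset.sum_neg_distrib]
      have h₂ := Finset.sum_le_sum fun r (_ : r ∈ Finset.Ico 1 Q) =>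
        neg_sum_landau_le_landauExcess (m := m) (hpos r) (hcop r) (t + 1)
      have h₃ : 0 ≤ ∑ r ∈ (Finset.Ico 1 b).filter (¬ · < Q), landauExcess m (p ^ r) k (t + 1) :=
        Finset.sum_nonneg fun r hr => hQ _
          ((not_lt.1 (Finset.mem_filter.1 hr).2).trans (Nat.lt_pow_self hp.one_lt).le)
          (hpos r) (hcop r) _
      linarith
    have h₂ := Int.self_le_toNat
      (∑ r ∈ Finset.Ico 1 Q, ∑ n ∈ Finset.range (p ^ r), landau m (p ^ r) n)
    zify
    linarith

lemma exists_sum_factorization_le (hm : ∀ i, 0 < m i)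
    (hgcd : Finset.univ.gcd m = 1) (hk : 0 < k) :
    ∃ (Q : ℕ) (B : ℕ → ℕ), (∀ p, Q ≤ p → B p = 0) ∧ ∀ p, p.Prime → ∀ t,
      ∑ n ∈ Finset.Icc 1 t, (multinomialSeq m n).factorization p ≤
        ∑ n ∈ Finset.Icc 1 t, (multinomialSeq m (k * n)).factorization p + B p := by
  obtain ⟨Q, B, hB, hle⟩ := exists_sum_factorization_le_of_coprime hm hgcd hk
  -- For the finitely many primes dividing `k`, replace `k` by its part prime to `p`.
  have hdvd : ∀ p, ∃ D : ℕ, p.Prime → ∀ t,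
      ∑ n ∈ Finset.Icc 1 t, (multinomialSeq m n).factorization p ≤
        ∑ n ∈ Finset.Icc 1 t, (multinomialSeq m (k * n)).factorization p + D := fun p => by
    by_cases hp : p.Prime
    · obtain ⟨e, k', hk', rfl⟩ := Nat.exists_eq_pow_mul_and_not_dvd hk.ne' p hp.ne_one
      obtain ⟨-, B', -, hle'⟩ := exists_sum_factorization_le_of_coprime (k := k') hm hgcd
        (Nat.pos_of_mul_pos_left hk)
      refine ⟨B' p, fun _ t => ?_⟩
      simp_rw [mul_assoc, factorization_multinomialSeq_pow_mul hp]
      exact hle' p hp (Nat.coprime_comm.1 ((Nat.Prime.coprime_iff_not_dvd hp).2 hk')) t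
    · exact ⟨0, fun h => absurd h hp⟩
  choose D hD using hdvd
  refine ⟨max Q (k + 1), fun p => if p ≤ k then D p else B p, fun p hp => ?_, fun p hp t => ?_⟩
  · rw [max_le_iff] at hp
    simp only [if_neg (by omega : ¬p ≤ k), hB p hp.1]
  · dsimp only
    split_ifs with h
    · exact hD p hp t
    · exact hle p hp (Nat.coprime_comm.1 (Nat.coprime_of_lt_prime hk.ne' (not_le.1 h) hp)) t

end

/-! ### The common denominator -/

theorem theorem1 (s : ℕ) (m : Fin s → ℕ) (hm : ∀ i, 0 < m i)
    (hgcd : Finset.univ.gcd m = 1) (k : ℕ) (hk : 0 < k) :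
    AlmostMeanDivisible k (fun n => (multinomialSeq m n : ℤ)) := by
  refine ⟨fun n _ => Nat.cast_ne_zero.2 (multinomialSeq_pos m n).ne', ?_⟩
  obtain ⟨Q, B, hB, hle⟩ := exists_sum_factorization_le hm hgcd hk
  have hC : ∏ p ∈ (Finset.range Q).filter Nat.Prime, p ^ B p ≠ 0 :=
    Finset.prod_ne_zero_iff.2 fun p hp => pow_ne_zero _ (Finset.mem_filter.1 hp).2.ne_zero
  refine ⟨∏ p ∈ (Finset.range Q).filter Nat.Prime, p ^ B p, Nat.pos_of_ne_zero hC, fun t _ => ?_⟩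
  have hBC : ∀ p, p.Prime →
      B p ≤ (∏ p ∈ (Finset.range Q).filter Nat.Prime, p ^ B p).factorization p := fun p hp => by
    rcases lt_or_ge p Q with h | h
    · exact (hp.pow_dvd_iff_le_factorization hC).1 (Finset.dvd_prod_of_mem (fun p => p ^ B p)
        (Finset.mem_filter.2 ⟨Finset.mem_range.2 h, hp⟩))
    · simp [hB p h]
  generalize ∏ p ∈ (Finset.range Q).filter Nat.Prime, p ^ B p = C at hC hBC
  have hprod : ∀ j, ∏ n ∈ Finset.Icc 1 t, multinomialSeq m (j * n) ≠ 0 := fun j =>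
    Finset.prod_ne_zero_iff.2 fun n _ => (multinomialSeq_pos m _).ne'
  have h1 := hprod 1
  simp_rw [one_mul] at h1
  have hdvd : ∏ n ∈ Finset.Icc 1 t, multinomialSeq m n ∣
      C * ∏ n ∈ Finset.Icc 1 t, multinomialSeq m (k * n) := by
    refine (Nat.factorization_prime_le_iff_dvd h1 (mul_ne_zero hC (hprod k))).1 fun p hp => ?_
    rw [Nat.factorization_mul hC (hprod k), Finsupp.add_apply,
      Nat.factorization_prod_apply fun n _ => (multinomialSeq_pos m _).ne',
      Nat.factorization_prod_apply fun n _ => (multinomialSeq_pos m _).ne']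
    have := hle p hp t
    have := hBC p hp
    omega
  obtain ⟨z, hz⟩ := hdvd
  refine ⟨z, ?_⟩
  have hC' : (C : ℚ) ≠ 0 := by exact_mod_cast hC
  have h1' : (∏ n ∈ Finset.Icc 1 t, (multinomialSeq m n : ℚ)) ≠ 0 := by exact_mod_cast h1
  have hz' : (C : ℚ) * ∏ n ∈ Finset.Icc 1 t, (multinomialSeq m (k * n) : ℚ) =
      (∏ n ∈ Finset.Icc 1 t, (multinomialSeq m n : ℚ)) * z := by exact_mod_cast hz
  simp only [Int.cast_natCast]
  rw [div_eq_iff h1', one_div, mul_assoc, eq_inv_mul_iff_mul_eq₀ hC', hz', mul_comm]
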